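/- Let $H(\mathbb{C})$ be the algebra of entire functions with the compact-open topology and $D f=f'$. Let $\Phi(z)=\sum_{n\ge 0}a_nz^n$ be an entire function of exponential type (that is, $|\Phi(z)|\le A e^{B|z|}$ for all $z\in\mathbb{C}$, for some constants $A,B$) satisfying $|\Phi(0)|=1$, $\Phi''(0)\Phi(0)\ne\Phi'(0)^2$ and $\Phi'(0)\ne 0$, and let $\Phi(D):H(\mathbb{C})\to H(\mathbb{C})$, $f\mapsto\sum_{n\ge0}a_nD^nf$. Then the set of hypercyclic vectors of $\Phi(D)$, i.e. of those $f\in H(\mathbb{C})$ whose orbit $\{\Phi(D)^nf: n\ge 0\}$ is dense in $H(\mathbb{C})$, is densely strongly algebrable: there is an infinite, algebraically independent set $G\subset H(\mathbb{C})$ such that the (not necessarily unital) subalgebra generated by $G$, consisting of the values at elements of $G$ of complex polynomials without constant term, is dense in $H(\mathbb{C})$ and each of its nonzero elements is a hypercyclic vector of $\Phi(D)$. -/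

import Mathlib

open scoped Nat

/-- `Φ` is an entire function of exponential type: `|Φ(z)| ≤ A e^{B|z|}` for all `z ∈ ℂ`,
for some constants `A`, `B`. -/
def IsEntireOfExponentialType (Φ : ℂ → ℂ) : Prop :=
  Differentiable ℂ Φ ∧ ∃ A B : ℝ, ∀ z : ℂ, ‖Φ z‖ ≤ A * Real.exp (B * ‖z‖)

/-- The algebra `H(ℂ)` of entire functions, a subalgebra of `C(ℂ, ℂ)`; as a subspace of `C(ℂ, ℂ)`
it carries the compact-open topology, and its product is the pointwise product. -/
def EntireFunctions : Subalgebra ℂ C(ℂ, ℂ) where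
  carrier := {f | Differentiable ℂ (f : ℂ → ℂ)}
  mul_mem' := fun hf hg => Differentiable.mul hf hg
  one_mem' := differentiable_const 1
  add_mem' := fun hf hg => Differentiable.add hf hg
  zero_mem' := differentiable_const 0
  algebraMap_mem' := fun c => differentiable_const c

/-- Complex differentiation `D : H(ℂ) → H(ℂ)`, `f ↦ f'`. -/
noncomputable def entireDeriv : EntireFunctions →ₗ[ℂ] EntireFunctions where
  toFun f := ⟨⟨deriv (f : C(ℂ, ℂ)), (Differentiable.deriv f.2).continuous⟩,
    Differentiable.deriv f.2⟩
  map_add' f g := by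
    ext z
    exact deriv_add (f.2 z) (g.2 z)
  map_smul' c f := by
    ext z
    exact deriv_const_smul_field c (f : C(ℂ, ℂ))

/-- The operator `Φ(D) : H(ℂ) → H(ℂ)`, `f ↦ ∑ aₙ Dⁿ f`, where `Φ(z) = ∑ aₙ zⁿ`, i.e.
`aₙ = Φ⁽ⁿ⁾(0) / n!`. The series is taken in the topology of `H(ℂ)`; it converges for every `f`
when `Φ` is of exponential type, see `hasSum_convolutionOperator`. -/
noncomputable def convolutionOperator (Φ : ℂ → ℂ) (f : EntireFunctions) : EntireFunctions :=
  ∑' n : ℕ, (iteratedDeriv n Φ 0 / (n ! : ℂ)) • (entireDeriv ^ n) f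

/-- The hypercyclic vectors of a self-map `T`: the points whose orbit `{Tⁿ x : n ≥ 0}` is dense. -/
def hypercyclicVectors {X : Type*} [TopologicalSpace X] (T : X → X) : Set X :=
  {x | Dense (Set.range fun n : ℕ => T^[n] x)}

/-- A subset `S` of a commutative topological algebra `X` over `ℂ` is densely strongly algebrable:
`S ∪ {0}` contains a dense subalgebra of `X` generated by an infinite set of free generators.
Subalgebras need not contain the unit: the subalgebra generated by `G` consists of the
values at elements of `G` of polynomials without constant term. -/
def DenselyStronglyAlgebrable {X : Type*} [CommRing X] [Algebra ℂ X] [TopologicalSpace X]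
    (S : Set X) : Prop :=
  ∃ G : Set X, G.Infinite ∧ AlgebraicIndependent ℂ (fun g : G => (g : X)) ∧
    Dense (NonUnitalAlgebra.adjoin ℂ G : Set X) ∧
    (NonUnitalAlgebra.adjoin ℂ G : Set X) ⊆ S ∪ {0}

theorem coe_entireDeriv_pow (n : ℕ) (f : EntireFunctions) :
    (((entireDeriv ^ n) f : EntireFunctions) : C(ℂ, ℂ)) =
      (iteratedDeriv n (f : C(ℂ, ℂ)) : ℂ → ℂ) := by
  induction n with
  | zero => simp
  | succ n ih =>
    rw [pow_succ', iteratedDeriv_succ, ← ih]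
    rfl

/-- Cauchy estimate for the Taylor coefficients, scaled: `|Φ⁽ⁿ⁾(0)| ≤ C Kⁿ`. -/
theorem IsEntireOfExponentialType.exists_bound {Φ : ℂ → ℂ} (h : IsEntireOfExponentialType Φ) :
    ∃ C K : ℝ, 0 < C ∧ 0 < K ∧ ∀ n : ℕ, ‖iteratedDeriv n Φ 0‖ ≤ C * K ^ n := by
  obtain ⟨hd, A, B, hAB⟩ := h
  have hb : ∀ z : ℂ, ‖Φ z‖ ≤ (|A| + 1) * Real.exp ((|B| + 1) * ‖z‖) := fun z => by
    refine (hAB z).trans ?_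
    have h1 : A ≤ |A| + 1 := (le_abs_self A).trans (by linarith)
    have h2 : B ≤ |B| + 1 := (le_abs_self B).trans (by linarith)
    gcongr
  refine ⟨|A| + 1, Real.exp (|B| + 1), by positivity, by positivity, fun n => ?_⟩
  rcases Nat.eq_zero_or_pos n with rfl | hn
  · simpa using hb 0
  have hn' : (0 : ℝ) < n := by exact_mod_cast hn
  have := Complex.norm_iteratedDeriv_le_of_forall_mem_sphere_norm_le (c := (0 : ℂ)) n hn'
    hd.diffContOnCl (C := (|A| + 1) * Real.exp ((|B| + 1) * n)) (fun z hz => by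
      have hz' : ‖z‖ = n := by simpa using hz
      simpa [hz'] using hb z)
  refine this.trans ?_
  rw [mul_comm (|B| + 1) (n : ℝ), Real.exp_nat_mul]
  rw [div_le_iff₀ (by positivity)]
  have hfac : (n ! : ℝ) ≤ (n : ℝ) ^ n := by exact_mod_cast Nat.factorial_le_pow n
  rw [mul_comm]
  gcongr

theorem isClosed_entireFunctions : IsClosed (EntireFunctions : Set C(ℂ, ℂ)) := by
  rw [isClosed_iff_clusterPt]
  intro f hf
  rw [← mem_closure_iff_clusterPt, mem_closure_iff_seq_limit] at hf
  obtain ⟨u, hu, hlim⟩ := hf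
  rw [ContinuousMap.tendsto_iff_tendstoLocallyUniformly,
    ← tendstoLocallyUniformlyOn_univ] at hlim
  have := hlim.differentiableOn
    (Filter.Eventually.of_forall fun n => (hu n : Differentiable ℂ (u n)).differentiableOn)
    isOpen_univ
  exact differentiableOn_univ.1 this

/-- For `Φ` of exponential type, the series `∑ aₙ Dⁿ f` converges in `H(ℂ)` to `Φ(D) f`. -/
theorem hasSum_convolutionOperator {Φ : ℂ → ℂ} (h : IsEntireOfExponentialType Φ)
    (f : EntireFunctions) :
    HasSum (fun n : ℕ => (iteratedDeriv n Φ 0 / (n ! : ℂ)) • (entireDeriv ^ n) f)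
      (convolutionOperator Φ f) := by
  refine Summable.hasSum ?_
  obtain ⟨C, K, hC, hK, hb⟩ := h.exists_bound
  set F : ℕ → EntireFunctions := fun n => (iteratedDeriv n Φ 0 / (n ! : ℂ)) • (entireDeriv ^ n) f
  have key : Summable fun n => (F n : C(ℂ, ℂ)) := by
    refine ContinuousMap.summable_of_locally_summable_norm fun S => ?_
    obtain ⟨r, hr⟩ := S.isCompact.isBounded.subset_closedBall (0 : ℂ)
    obtain ⟨M, hM⟩ := (isCompact_closedBall (0 : ℂ) (r + 2 * K)).exists_bound_of_continuousOn
      (f := (f : C(ℂ, ℂ))) (f : C(ℂ, ℂ)).continuous.continuousOn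
    have hg : Summable fun n : ℕ => C * |M| * (1 / 2 : ℝ) ^ n :=
      summable_geometric_two.mul_left _
    refine Summable.of_nonneg_of_le (fun _ => norm_nonneg _) (fun n => ?_) hg
    rw [ContinuousMap.norm_le _ (by positivity)]
    rintro ⟨z, hz⟩
    have hz' : ‖z‖ ≤ r := by simpa using hr hz
    have e : (F n : C(ℂ, ℂ)) z
        = iteratedDeriv n Φ 0 / (n ! : ℂ) * iteratedDeriv n (f : C(ℂ, ℂ)) z := by
      rw [← coe_entireDeriv_pow]
      rfl
    have c := Complex.norm_iteratedDeriv_le_of_forall_mem_sphere_norm_le (c := z) n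
      (R := 2 * K) (by positivity) (f.2 : Differentiable ℂ (f : C(ℂ, ℂ))).diffContOnCl
      (C := |M|) (fun w hw => by
        refine (hM w ?_).trans (le_abs_self M)
        have : ‖w - z‖ = 2 * K := by simpa [dist_eq_norm] using hw
        have h3 : ‖w‖ ≤ ‖w - z‖ + ‖z‖ := by simpa using norm_add_le (w - z) z
        simp only [Metric.mem_closedBall, dist_zero_right]
        linarith)
    change ‖(F n : C(ℂ, ℂ)) z‖ ≤ _
    rw [e, norm_mul, norm_div, Complex.norm_natCast]
    calc ‖iteratedDeriv n Φ 0‖ / (n ! : ℝ) * ‖iteratedDeriv n (f : C(ℂ, ℂ)) z‖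
        ≤ C * K ^ n / (n ! : ℝ) * (n ! * |M| / (2 * K) ^ n) := by
          gcongr
          exact hb n
      _ = C * |M| * (1 / 2 : ℝ) ^ n := by
          rw [mul_pow, div_pow, one_pow]
          have : (n ! : ℝ) ≠ 0 := by positivity
          field_simp
  have hmem : ∑' n, (F n : C(ℂ, ℂ)) ∈ (EntireFunctions : Set C(ℂ, ℂ)) := by
    refine isClosed_entireFunctions.mem_of_tendsto key.hasSum.tendsto_sum_nat
      (Filter.Eventually.of_forall fun N => ?_)
    exact EntireFunctions.sum_mem fun n _ => (F n).2
  refine ⟨⟨_, hmem⟩, ?_⟩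
  rw [HasSum, Topology.IsInducing.subtypeVal.tendsto_nhds_iff]
  have := key.hasSum
  rw [HasSum] at this
  convert this using 2 with s
  simp

/-! The generators come from a Baire category argument in the space of sequences of entire
functions. For a finite set `S` of nonzero exponents it suffices to find a leading `μ ∈ S` such
that, for a dense set of sequences `f`, some `Φ(D)^N` sends the monomial `f^μ` into a given open set
and all other `f^ν` close to `0`. A generic `f` then makes every nonzero polynomial without constant
term hypercyclic at `f`, and algebraic independence follows because `0` is not hypercyclic.

Density rests on `Φ(D) e^{cz} = Φ(c) e^{cz}`. The hypotheses say that `log Φ` has nonzero first and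
second derivatives at `0`, so along some direction `u` the function `g(t) = log |Φ(tu)|` is strictly
decreasing and strictly convex near `0`, with `g 0 = 0` (`exists_hasConvexDirection`). Exponentials
with small `t > 0` decay under iteration, those with `t < 0` grow, and both families span densely.

With `m` the degree of `μ`, take combinations `A i` of decaying exponentials and add growing ones
with coefficients of size about `exp (-N g(mt) / m)`. In a product of `m` equal growing factors the
growth `exp (N g(mt))` is cancelled exactly; every other product of at most `m` factors tends to `0`
by strict convexity (`StrictConvexOn.map_sum_lt_sum_max`). Monomials of the same degree `m` are told
apart by powers of `N + 1` governed by a weight that only `μ` minimizes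
(`HasConvexDirection.exists_perturbation`). -/

open Filter Topology

/-! ### Topology of the algebra of entire functions. -/

instance EntireFunctions.instIsTopologicalRing : IsTopologicalRing EntireFunctions where
  toIsTopologicalSemiring := inferInstanceAs (IsTopologicalSemiring EntireFunctions.toSubsemiring)
  toContinuousNeg := ⟨by
    have h : Continuous fun f : EntireFunctions => (-1 : ℂ) • f := continuous_const_smul _
    exact h.congr fun f => neg_one_smul ℂ f⟩

instance EntireFunctions.instIsTopologicalAddGroup : IsTopologicalAddGroup EntireFunctions :=
  EntireFunctions.instIsTopologicalRing.to_topologicalAddGroup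

instance EntireFunctions.instSecondCountableTopology : SecondCountableTopology EntireFunctions :=
  inferInstanceAs (SecondCountableTopology (EntireFunctions : Set C(ℂ, ℂ)))

instance EntireFunctions.instCompleteSpace : CompleteSpace EntireFunctions :=
  isClosed_entireFunctions.completeSpace_coe

instance EntireFunctions.instIsCountablyGenerated :
    (uniformity EntireFunctions).IsCountablyGenerated :=
  inferInstanceAs (uniformity (EntireFunctions : Set C(ℂ, ℂ))).IsCountablyGenerated

theorem baireSpace_entireFunctions_seq : BaireSpace (ℕ → EntireFunctions) := by
  have : (uniformity (ℕ → EntireFunctions)).IsCountablyGenerated := inferInstance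
  have : CompleteSpace (ℕ → EntireFunctions) := inferInstance
  let _ := UniformSpace.pseudoMetricSpace (ℕ → EntireFunctions)
  exact BaireSpace.of_completelyPseudoMetrizable

/-- An entire function, as an element of the algebra of entire functions. -/
def Differentiable.toEntire {f : ℂ → ℂ} (hf : Differentiable ℂ f) : EntireFunctions :=
  ⟨⟨f, hf.continuous⟩, hf⟩

/-- Evaluation of entire functions at a point. -/
noncomputable def EntireFunctions.evalAt (z : ℂ) : EntireFunctions →ₐ[ℂ] ℂ where
  toFun f := (f : C(ℂ, ℂ)) z
  map_one' := rfl
  map_mul' _ _ := rfl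
  map_zero' := rfl
  map_add' _ _ := rfl
  commutes' _ := rfl

theorem EntireFunctions.ext_evalAt {f g : EntireFunctions} (h : ∀ z, evalAt z f = evalAt z g) :
    f = g :=
  Subtype.ext (ContinuousMap.ext h)

theorem EntireFunctions.continuous_evalAt (z : ℂ) : Continuous (evalAt z) :=
  (continuous_eval_const z).comp continuous_subtype_val

theorem EntireFunctions.tendsto_of_norm_le {ι : Type*} {l : Filter ι} {F : ι → EntireFunctions}
    {f : EntireFunctions}
    (h : ∀ R : ℝ, 0 < R → ∃ ε : ι → ℝ, Tendsto ε l (𝓝 0) ∧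
      ∀ᶠ i in l, ∀ z : ℂ, ‖z‖ ≤ R → ‖evalAt z (F i) - evalAt z f‖ ≤ ε i) :
    Tendsto F l (𝓝 f) := by
  rw [tendsto_subtype_rng, ContinuousMap.tendsto_iff_forall_isCompact_tendstoUniformlyOn]
  intro K hK
  obtain ⟨r, hr⟩ := hK.isBounded.subset_closedBall (0 : ℂ)
  obtain ⟨ε, hε, hb⟩ := h (max r 1) (by positivity)
  rw [Metric.tendstoUniformlyOn_iff]
  intro δ hδ
  filter_upwards [hb, hε.eventually_lt_const hδ] with i hi hi' z hz
  rw [dist_comm, dist_eq_norm]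
  refine (hi z ?_).trans_lt hi'
  have := hr hz
  simp only [Metric.mem_closedBall, dist_zero_right] at this
  exact this.trans (le_max_left _ _)

theorem EntireFunctions.exists_bound_of_tendsto_zero {ι : Type*} {l : Filter ι}
    {F : ι → EntireFunctions} (h : Tendsto F l (𝓝 0)) (R : ℝ) {δ : ℝ} (hδ : 0 < δ) :
    ∀ᶠ i in l, ∀ z : ℂ, ‖z‖ ≤ R → ‖evalAt z (F i)‖ ≤ δ := by
  rw [tendsto_subtype_rng, ContinuousMap.tendsto_iff_forall_isCompact_tendstoUniformlyOn] at h
  have := h _ (isCompact_closedBall (0 : ℂ) R)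
  rw [Metric.tendstoUniformlyOn_iff] at this
  filter_upwards [this δ hδ] with i hi z hz
  have := hi z (by simpa using hz)
  rw [dist_comm, dist_eq_norm] at this
  have h2 : ((0 : EntireFunctions) : C(ℂ, ℂ)) z = 0 := rfl
  rw [h2, sub_zero] at this
  exact this.le

/-! ### The operator `Φ(D)` is linear and continuous. -/

namespace IsEntireOfExponentialType

variable {Φ : ℂ → ℂ}

/-- `Φ(D)` as a linear map. -/
noncomputable def convolutionLinearMap (h : IsEntireOfExponentialType Φ) :
    EntireFunctions →ₗ[ℂ] EntireFunctions where
  toFun := convolutionOperator Φ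
  map_add' f g := by
    refine (hasSum_convolutionOperator h (f + g)).unique ?_
    simpa using (hasSum_convolutionOperator h f).add (hasSum_convolutionOperator h g)
  map_smul' c f := by
    refine (hasSum_convolutionOperator h (c • f)).unique ?_
    have := (hasSum_convolutionOperator h f).const_smul c
    simpa only [map_smul, smul_comm c, RingHom.id_apply] using this

@[simp]
theorem convolutionLinearMap_apply (h : IsEntireOfExponentialType Φ) (f : EntireFunctions) :
    h.convolutionLinearMap f = convolutionOperator Φ f :=
  rfl

theorem hasSum_evalAt_convolutionOperator (h : IsEntireOfExponentialType Φ) (f : EntireFunctions)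
    (z : ℂ) :
    HasSum (fun n : ℕ => iteratedDeriv n Φ 0 / (n ! : ℂ) * iteratedDeriv n (f : C(ℂ, ℂ)) z)
      (EntireFunctions.evalAt z (convolutionOperator Φ f)) := by
  have := (hasSum_convolutionOperator h f).map (EntireFunctions.evalAt z)
    (EntireFunctions.continuous_evalAt z)
  convert! this using 2 with n
  simp only [Function.comp, map_smul, smul_eq_mul]
  congr 1
  rw [← coe_entireDeriv_pow]
  rfl

/-- Cauchy estimates on circles of radius `2K`, against coefficients bounded by `C K^n / n!`, leave
a geometric series of ratio `1/2`. This is the quantitative form of continuity. -/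
theorem exists_norm_convolutionOperator_le (h : IsEntireOfExponentialType Φ) :
    ∃ C K : ℝ, 0 < C ∧ 0 < K ∧ ∀ (R M : ℝ) (f : EntireFunctions),
      (∀ z, ‖z‖ ≤ R + K → ‖EntireFunctions.evalAt z f‖ ≤ M) →
      ∀ z, ‖z‖ ≤ R → ‖EntireFunctions.evalAt z (convolutionOperator Φ f)‖ ≤ C * M := by
  obtain ⟨C, K, hC, hK, hb⟩ := h.exists_bound
  refine ⟨C * 2, 2 * K, by positivity, by positivity, fun R M f hf z hz => ?_⟩
  have hg : HasSum (fun n : ℕ => C * M * (1 / 2 : ℝ) ^ n) (C * M * 2) :=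
    hasSum_geometric_two.mul_left _
  have hs := h.hasSum_evalAt_convolutionOperator f z
  rw [← hs.tsum_eq, mul_right_comm]
  refine tsum_of_norm_bounded hg fun n => ?_
  have c := Complex.norm_iteratedDeriv_le_of_forall_mem_sphere_norm_le (c := z) n
    (R := 2 * K) (by positivity) (f.2 : Differentiable ℂ (f : C(ℂ, ℂ))).diffContOnCl
    (C := M) (fun w hw => by
      refine hf w ?_
      have : ‖w - z‖ = 2 * K := by simpa [dist_eq_norm] using hw
      have h3 : ‖w‖ ≤ ‖w - z‖ + ‖z‖ := by simpa using norm_add_le (w - z) z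
      linarith)
  rw [norm_mul, norm_div, Complex.norm_natCast]
  calc ‖iteratedDeriv n Φ 0‖ / (n ! : ℝ) * ‖iteratedDeriv n (f : C(ℂ, ℂ)) z‖
      ≤ C * K ^ n / (n ! : ℝ) * (n ! * M / (2 * K) ^ n) := by
        gcongr
        exact hb n
    _ = C * M * (1 / 2 : ℝ) ^ n := by
        rw [mul_pow, div_pow, one_pow]
        have : (n ! : ℝ) ≠ 0 := by positivity
        field_simp

theorem continuous_convolutionOperator (h : IsEntireOfExponentialType Φ) :
    Continuous (convolutionOperator Φ) := by
  obtain ⟨C, K, hC, hK, hb⟩ := h.exists_norm_convolutionOperator_le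
  refine continuous_of_continuousAt_zero h.convolutionLinearMap ?_
  rw [ContinuousAt, map_zero]
  rw [tendsto_subtype_rng, ContinuousMap.tendsto_iff_forall_isCompact_tendstoUniformlyOn]
  intro S hS
  obtain ⟨r, hr⟩ := hS.isBounded.subset_closedBall (0 : ℂ)
  rw [Metric.tendstoUniformlyOn_iff]
  intro δ hδ
  filter_upwards [EntireFunctions.exists_bound_of_tendsto_zero (tendsto_id (α := EntireFunctions))
    (r + K) (δ := δ / (2 * C)) (by positivity)] with f hf z hz
  have h2 : ((0 : EntireFunctions) : C(ℂ, ℂ)) z = 0 := rfl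
  rw [h2, dist_zero_left]
  have := hb r _ f hf z (by simpa using hr hz)
  refine lt_of_le_of_lt this ?_
  have : C * (δ / (2 * C)) = δ / 2 := by field_simp
  rw [this]
  linarith

end IsEntireOfExponentialType

/-! ### Exponentials: eigenvectors of `Φ(D)` with dense spans. -/

/-- The entire function `z ↦ exp (c z)`. -/
noncomputable def entireExp (c : ℂ) : EntireFunctions :=
  Differentiable.toEntire (f := fun z => Complex.exp (c * z)) (by fun_prop)

@[simp]
theorem evalAt_entireExp (c z : ℂ) :
    EntireFunctions.evalAt z (entireExp c) = Complex.exp (c * z) :=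
  rfl

theorem entireExp_nsmul (n : ℕ) (a : ℂ) : entireExp (n * a) = entireExp a ^ n :=
  EntireFunctions.ext_evalAt fun z => by simp [mul_assoc, Complex.exp_nat_mul]

theorem IsEntireOfExponentialType.convolutionOperator_entireExp {Φ : ℂ → ℂ}
    (h : IsEntireOfExponentialType Φ) (c : ℂ) :
    convolutionOperator Φ (entireExp c) = Φ c • entireExp c := by
  refine EntireFunctions.ext_evalAt fun z => ?_
  refine (h.hasSum_evalAt_convolutionOperator _ z).unique ?_
  have h1 := (Complex.hasSum_taylorSeries_of_entire h.1 0 c).mul_right (Complex.exp (c * z))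
  rw [map_smul, evalAt_entireExp, smul_eq_mul]
  convert! h1 using 2 with n
  have : iteratedDeriv n (entireExp c : C(ℂ, ℂ)) z = c ^ n * Complex.exp (c * z) := by
    have := congrFun (iteratedDeriv_cexp_const_mul n c) z
    exact this
  rw [this]
  simp only [sub_zero, smul_eq_mul]
  ring

theorem IsEntireOfExponentialType.iterate_convolutionOperator_sum {Φ : ℂ → ℂ}
    (h : IsEntireOfExponentialType Φ) {ι : Type*} (s : Finset ι) (a c : ι → ℂ) (n : ℕ) :
    (convolutionOperator Φ)^[n] (∑ i ∈ s, a i • entireExp (c i)) =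
      ∑ i ∈ s, (a i * Φ (c i) ^ n) • entireExp (c i) := by
  induction n with
  | zero => simp
  | succ n ih =>
    rw [Function.iterate_succ_apply', ih, ← h.convolutionLinearMap_apply, map_sum]
    refine Finset.sum_congr rfl fun i _ => ?_
    rw [map_smul, h.convolutionLinearMap_apply, h.convolutionOperator_entireExp, smul_smul]
    ring_nf

/-- The entire function `z ↦ z`. -/
noncomputable def entireId : EntireFunctions :=
  Differentiable.toEntire differentiable_id

@[simp]
theorem evalAt_entireId (z : ℂ) : EntireFunctions.evalAt z entireId = z :=
  rfl

theorem EntireFunctions.evalAt_sub (z : ℂ) (f g : EntireFunctions) :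
    evalAt z (f - g) = evalAt z f - evalAt z g :=
  rfl

theorem EntireFunctions.tendsto_taylor (f : EntireFunctions) :
    Tendsto (fun N : ℕ => ∑ n ∈ Finset.range N,
      (iteratedDeriv n (f : C(ℂ, ℂ)) 0 / (n ! : ℂ)) • entireId ^ n) atTop (𝓝 f) := by
  refine tendsto_of_norm_le fun R hR => ?_
  obtain ⟨M, hM⟩ := (isCompact_closedBall (0 : ℂ) (2 * R)).exists_bound_of_continuousOn
    (f := (f : C(ℂ, ℂ))) (f : C(ℂ, ℂ)).continuous.continuousOn
  have ht : Tendsto (fun N : ℕ => M * (1 / 2 : ℝ) ^ N / (1 - 1 / 2)) atTop (𝓝 0) := by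
    have := ((tendsto_pow_atTop_nhds_zero_of_lt_one (r := (1 / 2 : ℝ)) (by norm_num)
      (by norm_num)).const_mul M).div_const (1 - 1 / 2)
    simpa using this
  refine ⟨_, ht, Eventually.of_forall fun N z hz => ?_⟩
  have hs := Complex.hasSum_taylorSeries_of_entire
    (f.2 : Differentiable ℂ (f : C(ℂ, ℂ))) 0 z
  have := norm_sub_le_of_geometric_bound_of_hasSum (r := 1 / 2) (C := M) (by norm_num)
    (fun n => ?_) hs N
  · refine le_trans (le_of_eq ?_) this
    rw [map_sum]
    congr 2
    refine Finset.sum_congr rfl fun n _ => ?_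
    simp only [map_smul, map_pow, evalAt_entireId, smul_eq_mul, sub_zero]
    ring
  · have c := Complex.norm_iteratedDeriv_le_of_forall_mem_sphere_norm_le (c := (0 : ℂ)) n
      (R := 2 * R) (by positivity) (f.2 : Differentiable ℂ (f : C(ℂ, ℂ))).diffContOnCl
      (C := M) (fun w hw => hM w (Metric.sphere_subset_closedBall hw))
    simp only [sub_zero, smul_eq_mul, norm_mul, norm_inv, Complex.norm_natCast, norm_pow]
    have hM0 : 0 ≤ M := (norm_nonneg _).trans (hM 0 (by simp; positivity))
    calc ((n ! : ℝ))⁻¹ * (‖z‖ ^ n * ‖iteratedDeriv n (f : C(ℂ, ℂ)) 0‖)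
        ≤ ((n ! : ℝ))⁻¹ * (R ^ n * (n ! * M / (2 * R) ^ n)) := by gcongr
      _ = M * (1 / 2 : ℝ) ^ n := by
        rw [mul_pow, div_pow, one_pow]
        have : (n ! : ℝ) ≠ 0 := by positivity
        field_simp

theorem tendsto_entireExp_smul_sub_one {l : Filter ℝ} (hl : l ≤ 𝓝[≠] 0) {u : ℂ} (hu : u ≠ 0) :
    Tendsto (fun t : ℝ => ((t * u : ℂ))⁻¹ • (entireExp (t * u) - 1)) l (𝓝 entireId) := by
  refine EntireFunctions.tendsto_of_norm_le fun R hR => ⟨fun t => ‖(t * u : ℂ)‖ * R ^ 2, ?_, ?_⟩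
  · have : Continuous fun t : ℝ => ‖(t * u : ℂ)‖ * R ^ 2 := by fun_prop
    have := this.tendsto 0
    simp only [Complex.ofReal_zero, zero_mul, norm_zero] at this
    exact this.mono_left (hl.trans nhdsWithin_le_nhds)
  · have h1 : ∀ᶠ t : ℝ in l, ‖(t * u : ℂ)‖ * R < 1 := by
      have : Continuous fun t : ℝ => ‖(t * u : ℂ)‖ * R := by fun_prop
      have := this.tendsto 0
      simp only [Complex.ofReal_zero, zero_mul, norm_zero] at this
      exact (this.mono_left (hl.trans nhdsWithin_le_nhds)).eventually_lt_const one_pos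
    have h2 : ∀ᶠ t : ℝ in l, t ≠ 0 := hl self_mem_nhdsWithin
    filter_upwards [h1, h2] with t ht ht0 z hz
    have hc : (t * u : ℂ) ≠ 0 := mul_ne_zero (by exact_mod_cast ht0) hu
    generalize (t * u : ℂ) = c at *
    have hcz : ‖c * z‖ ≤ 1 := by
      rw [norm_mul]
      exact (by gcongr : ‖c‖ * ‖z‖ ≤ ‖c‖ * R).trans ht.le
    have := Complex.norm_exp_sub_one_sub_id_le hcz
    have e : EntireFunctions.evalAt z (c⁻¹ • (entireExp c - 1)) - EntireFunctions.evalAt z entireId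
        = c⁻¹ * (Complex.exp (c * z) - 1 - c * z) := by
      rw [map_smul, EntireFunctions.evalAt_sub]
      simp
      field_simp
    rw [e, norm_mul, norm_inv]
    have hc' : 0 < ‖c‖ := norm_pos_iff.2 hc
    calc ‖c‖⁻¹ * ‖Complex.exp (c * z) - 1 - c * z‖ ≤ ‖c‖⁻¹ * ‖c * z‖ ^ 2 := by gcongr
      _ = ‖c‖ * ‖z‖ ^ 2 := by rw [norm_mul]; field_simp
      _ ≤ ‖c‖ * R ^ 2 := by gcongr

theorem tendsto_entireExp_zero {l : Filter ℝ} (hl : l ≤ 𝓝[≠] 0) {u : ℂ} (hu : u ≠ 0) :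
    Tendsto (fun t : ℝ => entireExp (t * u)) l (𝓝 1) := by
  have h1 := tendsto_entireExp_smul_sub_one hl hu
  have h2 : Tendsto (fun t : ℝ => (t * u : ℂ)) l (𝓝 0) := by
    have : Continuous fun t : ℝ => (t * u : ℂ) := by fun_prop
    have := this.tendsto 0
    simp only [Complex.ofReal_zero, zero_mul] at this
    exact this.mono_left (hl.trans nhdsWithin_le_nhds)
  have h3 := (h2.smul h1).add_const 1
  rw [zero_smul, zero_add] at h3
  refine h3.congr' ?_
  have h4 : ∀ᶠ t : ℝ in l, t ≠ 0 := hl self_mem_nhdsWithin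
  filter_upwards [h4] with t ht0
  have hc : (t * u : ℂ) ≠ 0 := mul_ne_zero (by exact_mod_cast ht0) hu
  rw [smul_smul, mul_inv_cancel₀ hc, one_smul]
  exact EntireFunctions.ext_evalAt fun z => by simp [EntireFunctions.evalAt_sub]

/-- As `t → 0+`, `e^{tuz} ((e^{tuz} - 1) / (tu))^n` tends to `z^n`, so Taylor polynomials lie in the
closure of the span. The extra factor `e^{tuz}`, which tends to `1`, shifts the exponents to `t,
..., (n+1)t` and so avoids the excluded exponent `0`. -/
theorem dense_span_entireExp_pos {u : ℂ} (hu : u ≠ 0) {ε : ℝ} (hε : 0 < ε) :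
    Dense (Submodule.span ℂ ((fun t : ℝ => entireExp (t * u)) '' Set.Ioo 0 ε) :
      Set EntireFunctions) := by
  set p := Submodule.span ℂ ((fun t : ℝ => entireExp (t * u)) '' Set.Ioo 0 ε) with hp
  have hl : 𝓝[>] (0 : ℝ) ≤ 𝓝[≠] 0 := nhdsWithin_mono _ fun t ht => ne_of_gt ht
  have key : ∀ n : ℕ, entireId ^ n ∈ p.topologicalClosure := fun n => by
    have h1 := (tendsto_entireExp_zero hl hu).mul ((tendsto_entireExp_smul_sub_one hl hu).pow n)
    rw [one_mul] at h1
    refine mem_closure_of_tendsto h1 ?_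
    have h2 : Set.Ioo 0 (ε / (n + 1)) ∈ 𝓝[>] (0 : ℝ) := Ioo_mem_nhdsGT (by positivity)
    filter_upwards [h2] with t ht
    have e0 : entireExp (t * u) - 1 = entireExp (t * u) + -1 :=
      EntireFunctions.ext_evalAt fun z => by
        rw [EntireFunctions.evalAt_sub, map_add, sub_eq_add_neg]
        rfl
    rw [smul_pow, mul_smul_comm, e0, add_pow, Finset.mul_sum]
    refine p.smul_mem _ (p.sum_mem fun k hk => ?_)
    have hk' : (k : ℝ) ≤ n := by
      exact_mod_cast Nat.lt_succ_iff.1 (Finset.mem_range.1 hk)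
    have e : entireExp (t * u) * (entireExp (t * u) ^ k * (-1) ^ (n - k) *
        ((n.choose k : ℕ) : EntireFunctions)) = ((-1) ^ (n - k) * (n.choose k : ℂ)) •
        entireExp (((k + 1 : ℝ) * t : ℝ) * u) := by
      have : (((k + 1 : ℝ) * t : ℝ) * u : ℂ) = ((k + 1 : ℕ) : ℂ) * (t * u) := by
        push_cast; ring
      rw [this, entireExp_nsmul]
      refine EntireFunctions.ext_evalAt fun z => ?_
      have e1 : EntireFunctions.evalAt z (-1) = -1 := rfl
      simp only [map_mul, map_pow, e1, map_natCast, map_smul, smul_eq_mul]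
      ring
    rw [e]
    refine p.smul_mem _ (Submodule.subset_span ⟨_, ⟨by have := ht.1; positivity, ?_⟩, rfl⟩)
    calc (k + 1 : ℝ) * t < (k + 1) * (ε / (n + 1)) := by have := ht.2; gcongr
      _ ≤ (n + 1) * (ε / (n + 1)) := by gcongr
      _ = ε := by field_simp
  intro f
  refine p.isClosed_topologicalClosure.mem_of_tendsto (EntireFunctions.tendsto_taylor f)
    (Eventually.of_forall fun N => ?_)
  exact p.topologicalClosure.sum_mem fun n _ => p.topologicalClosure.smul_mem _ (key n)

theorem dense_span_entireExp_neg {u : ℂ} (hu : u ≠ 0) {ε : ℝ} (hε : 0 < ε) :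
    Dense (Submodule.span ℂ ((fun t : ℝ => entireExp (t * u)) '' Set.Ioo (-ε) 0) :
      Set EntireFunctions) := by
  have h := dense_span_entireExp_pos (neg_ne_zero.2 hu) hε
  suffices e : (fun t : ℝ => entireExp (t * u)) '' Set.Ioo (-ε) 0 =
      (fun t : ℝ => entireExp (t * -u)) '' Set.Ioo 0 ε by
    rwa [e]
  ext f
  constructor
  · rintro ⟨t, ht, rfl⟩
    exact ⟨-t, ⟨by linarith [ht.2], by linarith [ht.1]⟩, by simp⟩
  · rintro ⟨t, ht, rfl⟩
    exact ⟨-t, ⟨by linarith [ht.2], by linarith [ht.1]⟩, by simp⟩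

/-! ### A line through `0` along which `log |Φ|` is decreasing and convex. -/

theorem Complex.exists_re_mul_neg_and_re_sq_mul_pos {a c : ℂ} (ha : a ≠ 0) (hc : c ≠ 0) :
    ∃ u : ℂ, (u * a).re < 0 ∧ 0 < (u ^ 2 * c).re := by
  suffices h : ∃ u : ℂ, (u * a).re ≠ 0 ∧ 0 < (u ^ 2 * c).re by
    obtain ⟨u, h1, h2⟩ := h
    rcases lt_or_gt_of_ne h1 with h1 | h1
    · exact ⟨u, h1, h2⟩
    · exact ⟨-u, by simpa using h1, by simpa using h2⟩
  obtain ⟨w, hw⟩ := IsAlgClosed.exists_pow_nat_eq c⁻¹ two_pos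
  have hw0 : w ≠ 0 := by
    rintro rfl
    simp [hc.symm] at hw
  by_cases h : (w * a).re = 0
  -- Here `w a` is purely imaginary and nonzero, so the factor `1 + i/2` gives it a nonzero real
  -- part, while `(1 + i/2)² = 3/4 + i` keeps the real part of `u² c` positive.
  · refine ⟨w * (1 + Complex.I / 2), ?_, ?_⟩
    · intro h'
      refine mul_ne_zero hw0 ha (Complex.ext h ?_)
      have e : w * (1 + Complex.I / 2) * a = w * a + w * a * (Complex.I / 2) := by ring
      rw [e] at h'
      simpa [Complex.mul_re (w * a) (Complex.I / 2), h] using h'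
    · have e : (w * (1 + Complex.I / 2)) ^ 2 * c = 3 / 4 + Complex.I := by
        rw [mul_pow, hw]
        field_simp
        ring_nf
        simp
        ring
      rw [e]
      norm_num
  · refine ⟨w, h, ?_⟩
    rw [hw, inv_mul_cancel₀ hc]
    simp

/-- `Φ` has modulus `exp g` along the direction `u`, with `g` strictly decreasing, strictly convex
and vanishing at `0`. -/
structure HasConvexDirection (Φ : ℂ → ℂ) (u : ℂ) (r : ℝ) (g : ℝ → ℝ) : Prop where
  ne_zero : u ≠ 0
  pos : 0 < r
  map_zero : g 0 = 0
  strictAntiOn : StrictAntiOn g (Set.Ioo (-r) r)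
  strictConvexOn : StrictConvexOn ℝ (Set.Ioo (-r) r) g
  norm_eq : ∀ t ∈ Set.Ioo (-r) r, ‖Φ (t * u)‖ = Real.exp (g t)

/-- Along a suitable line through `0`, `log |Φ|` is strictly decreasing and strictly convex. -/
theorem exists_hasConvexDirection {Φ : ℂ → ℂ} (hΦ : Differentiable ℂ Φ) (h0 : ‖Φ 0‖ = 1)
    (h2 : iteratedDeriv 2 Φ 0 * Φ 0 ≠ (deriv Φ 0) ^ 2) (h1 : deriv Φ 0 ≠ 0) :
    ∃ (u : ℂ) (r : ℝ) (g : ℝ → ℝ), HasConvexDirection Φ u r g := by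
  have hΦ0 : Φ 0 ≠ 0 := by
    intro h
    simp [h] at h0
  -- Dividing by `Φ 0` puts the argument at `1`, inside the slit plane; since `|Φ 0| = 1`, the real
  -- part of `L` is still `log |Φ|`.
  set L : ℂ → ℂ := fun z => Complex.log (Φ z / Φ 0) with hL
  have hLa : AnalyticAt ℂ L 0 := by
    refine ((hΦ.analyticAt 0).div_const).clog ?_
    simp [hΦ0]
  have hnear : ∀ᶠ z in 𝓝 (0 : ℂ), Φ z / Φ 0 ∈ Complex.slitPlane :=
    (hΦ.continuous.div_const (Φ 0)).continuousAt.eventually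
      (Complex.isOpen_slitPlane.mem_nhds (by simp [hΦ0]))
  have hd : ∀ᶠ z in 𝓝 (0 : ℂ), HasDerivAt L (deriv Φ z / Φ z) z := by
    filter_upwards [hnear] with z hz
    have hz0 : Φ z ≠ 0 := fun h => by simp [h] at hz
    have := ((hΦ z).hasDerivAt.div_const (Φ 0)).clog hz
    convert! this using 1
    field_simp
  have hd' : deriv L =ᶠ[𝓝 0] fun z => deriv Φ z / Φ z := hd.mono fun z hz => hz.deriv
  have hd2 : deriv (deriv L) 0 = (iteratedDeriv 2 Φ 0 * Φ 0 - deriv Φ 0 ^ 2) / Φ 0 ^ 2 := by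
    rw [hd'.deriv_eq, iteratedDeriv_succ, iteratedDeriv_one]
    have := ((hΦ.deriv 0).hasDerivAt).div (hΦ 0).hasDerivAt hΦ0
    rw [show (fun z => deriv Φ z / Φ z) = deriv Φ / Φ from rfl, this.deriv]
    ring
  have hne2 : deriv (deriv L) 0 ≠ 0 := by
    rw [hd2]
    exact div_ne_zero (sub_ne_zero.2 h2) (pow_ne_zero _ hΦ0)
  have hne1 : deriv L 0 ≠ 0 := by
    rw [hd'.self_of_nhds]
    exact div_ne_zero h1 hΦ0
  obtain ⟨u, hu1, hu2⟩ := Complex.exists_re_mul_neg_and_re_sq_mul_pos hne1 hne2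
  have hu0 : u ≠ 0 := by
    rintro rfl
    simp at hu1
  have hc1 : ContinuousAt (fun z => (u * deriv L z).re) 0 :=
    Complex.continuous_re.continuousAt.comp (continuousAt_const.mul hLa.deriv.continuousAt)
  have hc2 : ContinuousAt (fun z => (u ^ 2 * deriv (deriv L) z).re) 0 :=
    Complex.continuous_re.continuousAt.comp (continuousAt_const.mul hLa.deriv.deriv.continuousAt)
  have hev : ∀ᶠ z in 𝓝 (0 : ℂ), AnalyticAt ℂ L z ∧ Φ z / Φ 0 ∈ Complex.slitPlane ∧
      (u * deriv L z).re < 0 ∧ 0 < (u ^ 2 * deriv (deriv L) z).re := by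
    filter_upwards [hLa.eventually_analyticAt, hnear, hc1.eventually_lt_const hu1,
      hc2.eventually_const_lt hu2] with z e1 e2 e3 e4
    exact ⟨e1, e2, e3, e4⟩
  have hev' : ∀ᶠ t : ℝ in 𝓝 0, (fun z => AnalyticAt ℂ L z ∧ Φ z / Φ 0 ∈ Complex.slitPlane ∧
      (u * deriv L z).re < 0 ∧ 0 < (u ^ 2 * deriv (deriv L) z).re) (t * u) := by
    have : Continuous fun t : ℝ => (t * u : ℂ) := by fun_prop
    have := this.tendsto 0
    simp only [Complex.ofReal_zero, zero_mul] at this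
    exact this.eventually hev
  obtain ⟨r, hr, hball⟩ := Metric.eventually_nhds_iff_ball.1 hev'
  rw [Real.ball_eq_Ioo, zero_sub, zero_add] at hball
  set g : ℝ → ℝ := fun t => (L (t * u)).re with hg
  have hlin : ∀ t : ℝ, HasDerivAt (fun w : ℂ => w * u) u (t : ℂ) := fun t => by
    simpa using (hasDerivAt_id (t : ℂ)).mul_const u
  have hg1 : ∀ t ∈ Set.Ioo (-r) r, HasDerivAt g (u * deriv L (t * u)).re t := fun t ht => by
    have := ((hball t ht).1.differentiableAt.hasDerivAt.comp (t : ℂ) (hlin t))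
    rw [mul_comm u]
    exact this.real_of_complex
  have hg2 : ∀ t ∈ Set.Ioo (-r) r,
      HasDerivAt (deriv g) (u ^ 2 * deriv (deriv L) (t * u)).re t := fun t ht => by
    have := (((hball t ht).1.deriv.differentiableAt.hasDerivAt.comp (t : ℂ) (hlin t)).const_mul
      u).real_of_complex
    refine HasDerivAt.congr_of_eventuallyEq (f := fun t : ℝ => (u * deriv L (t * u)).re) ?_ ?_
    · convert! this using 2
      ring
    · filter_upwards [isOpen_Ioo.mem_nhds ht] with s hs
      exact (hg1 s hs).deriv
  have hcont : ContinuousOn g (Set.Ioo (-r) r) := fun t ht =>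
    (hg1 t ht).continuousAt.continuousWithinAt
  refine ⟨u, r, g, ⟨hu0, hr, by simp [hg, hL, hΦ0], ?_, ?_, fun t ht => ?_⟩⟩
  · refine strictAntiOn_of_deriv_neg (convex_Ioo _ _) hcont fun t ht => ?_
    rw [interior_Ioo] at ht
    rw [(hg1 t ht).deriv]
    exact (hball t ht).2.2.1
  · refine strictConvexOn_of_deriv2_pos (convex_Ioo _ _) hcont fun t ht => ?_
    rw [interior_Ioo] at ht
    rw [Function.iterate_succ, Function.iterate_one, Function.comp, (hg2 t ht).deriv]
    exact (hball t ht).2.2.2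
  · have hs := (hball t ht).2.1
    have hz0 : Φ (t * u) / Φ 0 ≠ 0 := Complex.slitPlane_ne_zero hs
    simp only [hg, hL, Complex.log_re]
    rw [Real.exp_log (norm_pos_iff.2 hz0), norm_div, h0, div_one]

/-! ### The convexity inequality comparing growth and decay rates. -/

/-- A weighted form of Jensen's inequality for a strictly convex function vanishing at `0`. -/
theorem StrictConvexOn.map_sum_lt_of_lt {s : Set ℝ} {g : ℝ → ℝ} (hg : StrictConvexOn ℝ s g)
    (h0 : g 0 = 0) (h0s : (0 : ℝ) ∈ s) {n m : ℕ} (hn : 0 < n) (hnm : n ≤ m) {y : Fin n → ℝ}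
    (hy : ∀ k, m * y k ∈ s) (hne : n = m → ¬∀ k l, y k = y l) (hsum : ∑ k, y k ≠ 0) :
    g (∑ k, y k) < ∑ k, g (m * y k) / m := by
  have hm : (0 : ℝ) < m := by exact_mod_cast hn.trans_le hnm
  have hn' : (0 : ℝ) < n := by exact_mod_cast hn
  rcases hnm.eq_or_lt with rfl | hlt
  · have := hg.map_sum_lt (t := Finset.univ) (w := fun _ : Fin n => (1 / n : ℝ))
      (p := fun k => n * y k) (fun _ _ => by positivity) (by simp; field_simp)
      (fun k _ => hy k) (by
        by_contra h
        push Not at h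
        refine hne rfl fun k l => ?_
        simpa [hn.ne'] using h k (Finset.mem_univ _) l (Finset.mem_univ _))
    refine lt_of_eq_of_lt ?_ (lt_of_lt_of_eq this ?_)
    · congr 1
      refine Finset.sum_congr rfl fun k _ => ?_
      simp only [smul_eq_mul]
      field_simp
    · refine Finset.sum_congr rfl fun k _ => ?_
      simp only [smul_eq_mul]
      ring
  · have hJ := hg.convexOn.map_sum_le (t := Finset.univ) (w := fun _ : Fin n => (1 / n : ℝ))
      (p := fun k => m * y k) (fun _ _ => by positivity) (by simp; field_simp)
      (fun k _ => hy k)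
    have hmem := hg.1.sum_mem (t := Finset.univ) (w := fun _ : Fin n => (1 / n : ℝ))
      (z := fun k => m * y k) (fun _ _ => by positivity) (by simp; field_simp)
      (fun k _ => hy k)
    have e : ∑ k, (1 / n : ℝ) • (m * y k) = m / n * ∑ k, y k := by
      rw [Finset.mul_sum]
      refine Finset.sum_congr rfl fun k _ => ?_
      simp only [smul_eq_mul]
      ring
    rw [e] at hJ hmem
    have hlt' : (n : ℝ) < m := by exact_mod_cast hlt
    have hlt1 : 0 < 1 - (n / m : ℝ) := by
      rw [sub_pos, div_lt_one hm]
      exact hlt'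
    -- When `n < m`, strictness comes from the segment joining `(m/n) ∑ y k` to `0`: these points
    -- differ because the sum is nonzero, and the weight `n/m` lies strictly between `0` and `1`.
    have := hg.2 hmem h0s (mul_ne_zero (by positivity) hsum) (by positivity : 0 < (n / m : ℝ))
      hlt1 (by ring)
    rw [h0] at this
    simp only [smul_eq_mul, mul_zero, add_zero] at this
    have e2 : (n / m : ℝ) * (m / n * ∑ k, y k) = ∑ k, y k := by field_simp
    rw [e2] at this
    refine this.trans_le ((mul_le_mul_of_nonneg_left hJ (by positivity)).trans_eq ?_)
    rw [Finset.mul_sum]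
    refine Finset.sum_congr rfl fun k _ => ?_
    simp only [smul_eq_mul]
    field_simp

theorem sum_mem_Ioo {r : ℝ} {n m : ℕ} (hn : 0 < n) (hnm : n ≤ m) {z : Fin n → ℝ}
    (hz : ∀ k, m * z k ∈ Set.Ioo (-r) r) : ∑ k, z k ∈ Set.Ioo (-r) r := by
  have hm : (0 : ℝ) < m := by exact_mod_cast hn.trans_le hnm
  have hr' : ∀ k, |z k| < r / m := fun k => by
    rw [lt_div_iff₀ hm, mul_comm]
    have := abs_lt.2 (hz k)
    rwa [abs_mul, abs_of_pos hm] at this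
  have hr : 0 < r / m := (abs_nonneg _).trans_lt (hr' ⟨0, hn⟩)
  have hne : (Finset.univ : Finset (Fin n)).Nonempty := ⟨⟨0, hn⟩, Finset.mem_univ _⟩
  refine abs_lt.1 ?_
  calc |∑ k, z k| ≤ ∑ k, |z k| := Finset.abs_sum_le_sum_abs _ _
    _ < ∑ _k : Fin n, r / m := Finset.sum_lt_sum_of_nonempty hne fun k _ => hr' k
    _ = n * (r / m) := by simp
    _ ≤ m * (r / m) := by gcongr
    _ = r := by field_simp

/-- If `g` is strictly convex and strictly decreasing with `g 0 = 0`, then the growth rate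
`g (∑ x k)` of a product of at most `m` factors is smaller than the sum of the decay rates
`max (g (m * x k)) 0 / m`, unless there are `m` equal negative factors. -/
theorem StrictConvexOn.map_sum_lt_sum_max {g : ℝ → ℝ} {r : ℝ} (hr : 0 < r)
    (hg : StrictConvexOn ℝ (Set.Ioo (-r) r) g) (ha : StrictAntiOn g (Set.Ioo (-r) r))
    (h0 : g 0 = 0) {n m : ℕ} (hn : 0 < n) (hnm : n ≤ m) {x : Fin n → ℝ}
    (hx : ∀ k, m * x k ∈ Set.Ioo (-r) r) (hx0 : ∀ k, x k ≠ 0)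
    (hne : ¬(n = m ∧ ∃ t < 0, ∀ k, x k = t)) :
    g (∑ k, x k) < ∑ k, max (g (m * x k)) 0 / m := by
  have hm : (0 : ℝ) < m := by exact_mod_cast hn.trans_le hnm
  have h0s : (0 : ℝ) ∈ Set.Ioo (-r) r := ⟨by linarith, hr⟩
  -- Truncating positive entries to `0` turns `max (g (m * x k)) 0` into `g (m * y k)`, and can only
  -- increase `g` of the sum because `g` decreases.
  set y : Fin n → ℝ := fun k => min (x k) 0 with hy
  have hym : ∀ k, m * y k ∈ Set.Ioo (-r) r := fun k => by
    rcases le_total (x k) 0 with h | h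
    · simpa [hy, min_eq_left h] using hx k
    · simpa [hy, min_eq_right h] using h0s
  have hyg : ∀ k, g (m * y k) = max (g (m * x k)) 0 := fun k => by
    rcases le_total (x k) 0 with h | h
    · have h' : m * x k ≤ 0 := mul_nonpos_of_nonneg_of_nonpos hm.le h
      have : 0 ≤ g (m * x k) := h0 ▸ ha.antitoneOn (hx k) h0s h'
      rw [max_eq_left this, hy]
      simp only [min_eq_left h]
    · have h' : 0 ≤ m * x k := by positivity
      have : g (m * x k) ≤ 0 := h0 ▸ ha.antitoneOn h0s (hx k) h'
      rw [max_eq_right this, hy]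
      simp only [min_eq_right h, mul_zero, h0]
  have hle : g (∑ k, x k) ≤ g (∑ k, y k) :=
    ha.antitoneOn (sum_mem_Ioo hn hnm hym) (sum_mem_Ioo hn hnm hx)
      (Finset.sum_le_sum fun k _ => min_le_left _ _)
  simp only [← hyg]
  by_cases hall : ∀ k, x k < 0
  · have hxy : y = x := funext fun k => min_eq_left (hall k).le
    rw [hxy]
    refine hg.map_sum_lt_of_lt h0 h0s hn hnm hx (fun h hc => hne ⟨h, x ⟨0, hn⟩, hall _, fun k =>
      hc k _⟩) (ne_of_lt ?_)
    exact Finset.sum_neg (fun k _ => hall k) ⟨⟨0, hn⟩, Finset.mem_univ _⟩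
  · push Not at hall
    obtain ⟨k₀, hk₀⟩ := hall
    have hk₀' : 0 < x k₀ := hk₀.lt_of_ne' (hx0 k₀)
    -- A positive entry already makes the truncation strict, so a weak inequality for `y` suffices
    -- from here.
    have hlt : g (∑ k, x k) < g (∑ k, y k) := by
      refine ha (sum_mem_Ioo hn hnm hym) (sum_mem_Ioo hn hnm hx)
        (Finset.sum_lt_sum (fun k _ => min_le_left _ _)
        ⟨k₀, Finset.mem_univ _, ?_⟩)
      simpa [hy] using hk₀'
    refine hlt.trans_le ?_
    by_cases hz : ∑ k, y k = 0
    · rw [hz, h0]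
      refine Finset.sum_nonneg fun k _ => ?_
      rw [hyg]
      positivity
    · by_cases hc : ∀ k l, y k = y l
      · refine absurd (Finset.sum_eq_zero fun k _ => ?_) hz
        rw [hc k k₀]
        exact min_eq_right hk₀
      · exact (hg.map_sum_lt_of_lt h0 h0s hn hnm hym (fun _ => hc) hz).le

/-! ### Limits of iterates on products of exponential sums. -/

theorem tendsto_add_one_pow_mul_exp_neg (p : ℕ) {δ : ℝ} (hδ : 0 < δ) :
    Tendsto (fun N : ℕ => (N + 1 : ℝ) ^ p * Real.exp (-(N * δ))) atTop (𝓝 0) := by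
  have h1 : |Real.exp (-δ)| < 1 := by
    rw [abs_of_pos (Real.exp_pos _)]
    rw [← Real.exp_zero]
    exact Real.exp_lt_exp.2 (by linarith)
  have h := ((tendsto_pow_const_mul_const_pow_of_abs_lt_one p h1).comp
    (tendsto_add_atTop_nat 1)).mul_const (Real.exp δ)
  rw [zero_mul] at h
  refine h.congr fun N => ?_
  simp only [Function.comp]
  rw [← Real.exp_nat_mul, mul_assoc, ← Real.exp_add]
  push_cast
  ring_nf

/-- The exponential factors combine to `exp (-N (∑ κ k - γ))`, which beats the polynomial factors.
-/
theorem tendsto_prod_mul_pow_zero {n : ℕ} {c : Fin n → ℕ → ℂ} {C κ : Fin n → ℝ} {p : Fin n → ℕ}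
    (hc : ∀ k N, ‖c k N‖ ≤ C k * (N + 1 : ℝ) ^ p k * Real.exp (-(N * κ k))) {w : ℂ} {γ : ℝ}
    (hw : ‖w‖ = Real.exp γ) (hlt : γ < ∑ k, κ k) :
    Tendsto (fun N : ℕ => (∏ k, c k N) * w ^ N) atTop (𝓝 0) := by
  have h := (tendsto_add_one_pow_mul_exp_neg (∑ k, p k) (sub_pos.2 hlt)).const_mul (∏ k, C k)
  rw [mul_zero] at h
  refine squeeze_zero_norm (fun N => ?_) h
  rw [norm_mul, norm_prod, norm_pow, hw, ← Real.exp_nat_mul]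
  calc (∏ k, ‖c k N‖) * Real.exp (N * γ)
      ≤ (∏ k, C k * (N + 1 : ℝ) ^ p k * Real.exp (-(N * κ k))) * Real.exp (N * γ) := by
        gcongr with k
        exact hc k N
    _ = _ := by
        rw [Finset.prod_mul_distrib, Finset.prod_mul_distrib, Finset.prod_pow_eq_pow_sum,
          ← Real.exp_sum, mul_assoc, mul_assoc, ← Real.exp_add]
        congr 3
        rw [Finset.sum_neg_distrib, ← Finset.mul_sum]
        ring

variable {Φ : ℂ → ℂ} {u : ℂ} {r : ℝ} {g : ℝ → ℝ}

/-- The limit of `Φ(D)^N` along products of exponential sums, whose coefficients are so small that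
only the `m`-fold products of equal exponentials with negative exponent contribute. -/
theorem HasConvexDirection.tendsto_iterate_prod (hg : HasConvexDirection Φ u r g)
    (hΦ : IsEntireOfExponentialType Φ) {n m : ℕ} (hn : 0 < n) (hnm : n ≤ m)
    (s : Fin n → Finset ℝ) (s' : Finset ℝ)
    (hs : ∀ k, ∀ t ∈ s k, 0 < t) (hs' : ∀ t ∈ s', t < 0)
    (hsr : ∀ k, ∀ t ∈ s k ∪ s', m * t ∈ Set.Ioo (-r) r)
    (c : Fin n → ℝ → ℕ → ℂ) (C : Fin n → ℝ → ℝ) (p : Fin n → ℝ → ℕ)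
    (hc : ∀ k, ∀ t ∈ s k ∪ s', ∀ N, ‖c k t N‖ ≤
      C k t * (N + 1 : ℝ) ^ p k t * Real.exp (-(N * (max (g (m * t)) 0 / m))))
    (d : ℝ → ℂ) (hd : n = m → ∀ t ∈ s',
      Tendsto (fun N => (∏ k, c k t N) * Φ ((m * t : ℝ) * u) ^ N) atTop (𝓝 (d t))) :
    Tendsto (fun N => (convolutionOperator Φ)^[N]
      (∏ k, ∑ t ∈ s k ∪ s', c k t N • entireExp (t * u))) atTop
      (𝓝 (if n = m then ∑ t ∈ s', d t • entireExp ((m * t : ℝ) * u) else 0)) := by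
  classical
  set k₀ : Fin n := ⟨0, hn⟩
  set F : Fin n → Finset ℝ := fun k => s k ∪ s' with hF
  set P : (Fin n → ℝ) → Prop := fun x => n = m ∧ ∃ t < 0, ∀ k, x k = t with hP
  have hterm : ∀ x ∈ Fintype.piFinset F,
      Tendsto (fun N => ((∏ k, c k (x k) N) * Φ ((∑ k, x k : ℝ) * u) ^ N) •
        entireExp ((∑ k, x k : ℝ) * u)) atTop
        (𝓝 (if P x then d (x k₀) • entireExp ((m * x k₀ : ℝ) * u) else 0)) := by
    intro x hx
    rw [Fintype.mem_piFinset] at hx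
    split_ifs with h
    · obtain ⟨hnm', t, ht, hxt⟩ := h
      have hsum : ∑ k, x k = m * t := by simp [hxt, hnm']
      have ht' : t ∈ s' := by
        have := hx k₀
        rw [hxt, hF, Finset.mem_union] at this
        exact this.resolve_left fun h => lt_asymm ht (hs _ _ h)
      rw [hsum]
      simp only [hxt]
      exact (hd hnm' t ht').smul_const _
    · have hx0 : ∀ k, x k ≠ 0 := fun k => by
        rcases Finset.mem_union.1 (hx k) with h | h
        · exact (hs _ _ h).ne'
        · exact (hs' _ h).ne
      have hxr : ∀ k, m * x k ∈ Set.Ioo (-r) r := fun k => hsr k _ (hx k)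
      have hlt := hg.strictConvexOn.map_sum_lt_sum_max hg.pos hg.strictAntiOn hg.map_zero hn hnm
        hxr hx0 h
      have := tendsto_prod_mul_pow_zero (c := fun k N => c k (x k) N)
        (C := fun k => C k (x k)) (p := fun k => p k (x k)) (fun k N => hc k _ (hx k) N)
        (hg.norm_eq _ (sum_mem_Ioo hn hnm hxr)) hlt
      simpa using this.smul_const (entireExp ((∑ k, x k : ℝ) * u))
  have hlim := tendsto_finsetSum _ hterm
  convert! hlim using 2 with N
  -- Expanding the product over tuples `x` of exponents, each term is again one exponential, with
  -- exponent `∑ x k`, hence an eigenvector.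
  · rw [← hΦ.iterate_convolutionOperator_sum, Finset.prod_univ_sum]
    congr 1
    refine Finset.sum_congr rfl fun x _ => ?_
    refine EntireFunctions.ext_evalAt fun z => ?_
    simp only [map_prod, map_smul, evalAt_entireExp, smul_eq_mul, Finset.prod_mul_distrib,
      Complex.ofReal_sum, Finset.sum_mul, Complex.exp_sum]
  · split_ifs with h
    · rw [← Finset.sum_filter]
      refine Finset.sum_bij' (fun t _ => fun _ => t) (fun x _ => x k₀) ?_ ?_ ?_ ?_ ?_
      · intro t ht
        rw [Finset.mem_filter, Fintype.mem_piFinset]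
        exact ⟨fun k => Finset.mem_union_right _ ht, h, t, hs' t ht, fun _ => rfl⟩
      · intro x hx
        rw [Finset.mem_filter, Fintype.mem_piFinset] at hx
        obtain ⟨hx, -, t, ht, hxt⟩ := hx
        have := hx k₀
        rw [hxt, hF, Finset.mem_union] at this
        rw [hxt]
        exact this.resolve_left fun h => lt_asymm ht (hs _ _ h)
      · intro t _
        rfl
      · intro x hx
        rw [Finset.mem_filter] at hx
        obtain ⟨-, -, t, -, hxt⟩ := hx
        funext k
        rw [hxt, hxt]
      · intro t _
        rfl
    · symm
      exact Finset.sum_eq_zero fun x _ => if_neg fun hx => h hx.1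

/-! ### Leading monomials. -/

theorem Finsupp.exists_injOn_weight (S : Finset (ℕ →₀ ℕ)) :
    ∃ w : ℕ → ℕ, Set.InjOn (Finsupp.weight w) (S : Set (ℕ →₀ ℕ)) := by
  classical
  set q : (ℕ →₀ ℕ) → Polynomial ℤ := fun ν => ν.sum fun i k => Polynomial.monomial i (k : ℤ) with hq
  have hcoeff : ∀ ν i, (q ν).coeff i = ν i := fun ν i => by
    simp only [hq, Finsupp.sum, Polynomial.finsetSum_coeff, Polynomial.coeff_monomial]
    rw [Finset.sum_ite_eq' ν.support i fun i => (ν i : ℤ)]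
    split_ifs with h
    · rfl
    · simp [Finsupp.notMem_support_iff.1 h]
  have hinj : Function.Injective q := fun ν ν' h => by
    ext i
    have := congrArg (fun p => Polynomial.coeff p i) h
    simpa [hcoeff] using this
  have heval : ∀ ν (K : ℕ), (q ν).eval (K : ℤ) = (Finsupp.weight (fun i => K ^ i) ν : ℕ) := by
    intro ν K
    simp [hq, Finsupp.sum, Polynomial.eval_finsetSum, Finsupp.weight_apply]
  -- Exponents are encoded as polynomials; a natural number `K` that is not a root of any difference
  -- makes the weight `i ↦ K^i` separate `S`.
  have hprod : ∏ x ∈ S.offDiag, (q x.1 - q x.2) ≠ 0 := by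
    refine Finset.prod_ne_zero_iff.2 fun x hx => sub_ne_zero.2 fun h => ?_
    exact (Finset.mem_offDiag.1 hx).2.2 (hinj h)
  obtain ⟨K, hK⟩ : ∃ K : ℕ, (∏ x ∈ S.offDiag, (q x.1 - q x.2)).eval (K : ℤ) ≠ 0 := by
    by_contra! h
    refine hprod (Polynomial.eq_zero_of_infinite_isRoot _ ?_)
    exact (Set.infinite_range_of_injective (Nat.cast_injective (R := ℤ))).mono
      (by rintro _ ⟨K, rfl⟩; exact h K)
  refine ⟨fun i => K ^ i, fun ν hν ν' hν' h => ?_⟩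
  by_contra hne
  rw [Polynomial.eval_prod, Finset.prod_ne_zero_iff] at hK
  refine hK (ν, ν') (Finset.mem_offDiag.2 ⟨hν, hν', hne⟩) ?_
  rw [Polynomial.eval_sub, heval, heval, h, sub_self]

/-- Every nonempty finite set of exponents has a leading one: it has maximal degree, and among
those of the same degree it is the unique minimizer of some weight. -/
theorem Finsupp.exists_leading {S : Finset (ℕ →₀ ℕ)} (hS : S.Nonempty) :
    ∃ μ ∈ S, ∃ w : ℕ → ℕ, ∀ ν ∈ S, ν.degree ≤ μ.degree ∧
      (ν ≠ μ → ν.degree = μ.degree → Finsupp.weight w μ < Finsupp.weight w ν) := by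
  classical
  obtain ⟨w, hw⟩ := Finsupp.exists_injOn_weight S
  obtain ⟨μ₀, hμ₀, hmax⟩ := S.exists_max_image Finsupp.degree hS
  obtain ⟨μ, hμ, hmin⟩ := (S.filter fun ν => ν.degree = μ₀.degree).exists_min_image
    (Finsupp.weight w) ⟨μ₀, by simp [hμ₀]⟩
  rw [Finset.mem_filter] at hμ
  refine ⟨μ, hμ.1, w, fun ν hν => ⟨hμ.2 ▸ hmax ν hν, fun hne hdeg => ?_⟩⟩
  refine (hmin ν (Finset.mem_filter.2 ⟨hν, hdeg.trans hμ.2⟩)).lt_of_ne fun h => ?_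
  exact hne (hw hμ.1 hν h).symm

/-- Lists the variables of a monomial with multiplicity, so that it becomes a product of `ν.degree`
factors to which `HasConvexDirection.tendsto_iterate_prod` applies. -/
theorem Finsupp.exists_list {M : Type*} [CommMonoid M] (ν : ℕ →₀ ℕ) :
    ∃ ι : Fin ν.degree → ℕ, (∀ f : ℕ → M, (ν.prod fun i k => f i ^ k) = ∏ k, f (ι k)) ∧
      ∀ w : ℕ → ℕ, Finsupp.weight w ν = ∑ k, w (ι k) := by
  have hlen : ν.toMultiset.toList.length = ν.degree := by
    rw [Multiset.length_toList, Finsupp.card_toMultiset]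
    rfl
  rw [← hlen]
  refine ⟨fun k => ν.toMultiset.toList.get k, fun f => ?_, fun w => ?_⟩
  · have h1 : (ν.toMultiset.map f).prod = ν.prod fun i k => f i ^ k := by
      rw [Finsupp.toMultiset_map, Finsupp.prod_toMultiset, Finsupp.prod_mapDomain_index] <;>
        simp [pow_add]
    rw [← h1, ← Multiset.prod_map_toList, ← List.prod_ofFn]
    congr 1
    exact (List.ofFn_getElem_eq_map _ f).symm
  · have h1 : (ν.toMultiset.map w).sum = Finsupp.weight w ν := by
      clear hlen
      induction ν using Finsupp.induction_linear with
      | zero => simp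
      | add ν ν' h h' => rw [map_add, Multiset.map_add, Multiset.sum_add, h, h', map_add]
      | single i k => simp [Finsupp.weight_single, Multiset.map_nsmul, Multiset.sum_nsmul]
    rw [← h1, ← Multiset.sum_map_toList, ← List.sum_ofFn]
    congr 1
    exact (List.ofFn_getElem_eq_map _ w).symm

/-! ### Perturbation by growing exponentials. -/

theorem prod_zpow_eq_zpow_sum₀ {ι K : Type*} [CommGroupWithZero K] {x : K} (hx : x ≠ 0)
    (s : Finset ι) (σ : ι → ℤ) : ∏ k ∈ s, x ^ σ k = x ^ ∑ k ∈ s, σ k := by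
  classical
  induction s using Finset.induction_on with
  | empty => simp
  | insert a s ha ih => rw [Finset.prod_insert ha, Finset.sum_insert ha, zpow_add₀ hx, ih]

theorem norm_natCast_add_one_zpow_le (N : ℕ) (z : ℤ) :
    ‖((N : ℂ) + 1) ^ z‖ ≤ (N + 1 : ℝ) ^ z.natAbs := by
  have h : ‖(N : ℂ) + 1‖ = N + 1 := by
    exact_mod_cast Complex.norm_natCast (N + 1)
  rw [norm_zpow, h, ← zpow_natCast]
  exact zpow_le_zpow_right₀ (by simp) Int.le_natAbs

theorem tendsto_natCast_add_one_zpow_zero {z : ℤ} (hz : z < 0) :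
    Tendsto (fun N : ℕ => ((N : ℂ) + 1) ^ z) atTop (𝓝 0) := by
  rw [tendsto_zero_iff_norm_tendsto_zero]
  have h := (tendsto_zpow_atTop_zero (𝕜 := ℝ) hz).comp
    ((tendsto_natCast_atTop_atTop (R := ℝ)).comp (tendsto_add_atTop_nat 1))
  refine h.congr fun N => ?_
  have h : ‖(N : ℂ) + 1‖ = N + 1 := by
    exact_mod_cast Complex.norm_natCast (N + 1)
  simp [h]

/-- Perturbation of a sequence of exponential sums, such that `Φ(D)^N` of a leading monomial
approaches a given exponential sum, and `Φ(D)^N` of the other monomials approaches `0`. -/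
theorem HasConvexDirection.exists_perturbation (hg : HasConvexDirection Φ u r g)
    (hΦ : IsEntireOfExponentialType Φ) {S : Finset (ℕ →₀ ℕ)} (hS : ∀ ν ∈ S, ν ≠ 0)
    {μ : ℕ →₀ ℕ} (hμ : μ ∈ S) {w : ℕ → ℕ}
    (hlead : ∀ ν ∈ S, ν.degree ≤ μ.degree ∧
      (ν ≠ μ → ν.degree = μ.degree → Finsupp.weight w μ < Finsupp.weight w ν))
    {A : ℕ → EntireFunctions} (hA : ∀ i, A i ∈ Submodule.span ℂ
      ((fun t : ℝ => entireExp (t * u)) '' Set.Ioo 0 (r / μ.degree)))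
    {v : EntireFunctions} (hv : v ∈ Submodule.span ℂ
      ((fun t : ℝ => entireExp (t * (μ.degree * u))) '' Set.Ioo (-(r / μ.degree)) 0)) :
    ∃ f : ℕ → ℕ → EntireFunctions, Tendsto f atTop (𝓝 A) ∧ ∀ ν ∈ S,
      Tendsto (fun N => (convolutionOperator Φ)^[N] (ν.prod fun i k => f N i ^ k)) atTop
        (𝓝 (if ν = μ then v else 0)) := by
  classical
  set m := μ.degree with hm
  have hm0 : m ≠ 0 := by
    rw [hm, Ne, Finsupp.degree_eq_zero_iff]
    exact hS μ hμ
  have hmpos : (0 : ℝ) < m := by positivity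
  simp only [Finsupp.mem_span_image_iff_linearCombination] at hA hv
  choose a ha haA using hA
  obtain ⟨b, hb, rfl⟩ := hv
  simp only [Finsupp.mem_supported] at ha hb
  have h0r : (0 : ℝ) ∈ Set.Ioo (-r) r := ⟨by linarith [hg.pos], hg.pos⟩
  have hat : ∀ i, ∀ t ∈ (a i).support, 0 < t ∧ m * t ∈ Set.Ioo (-r) r ∧ g (m * t) < 0 := by
    intro i t ht
    obtain ⟨h1, h2⟩ := ha i ht
    rw [lt_div_iff₀ hmpos] at h2
    have h3 : 0 < m * t := by positivity
    have h4 : m * t ∈ Set.Ioo (-r) r := ⟨by linarith [hg.pos], by linarith⟩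
    exact ⟨h1, h4, hg.map_zero ▸ hg.strictAntiOn h0r h4 h3⟩
  have hbt : ∀ t ∈ b.support, t < 0 ∧ m * t ∈ Set.Ioo (-r) r ∧ 0 < g (m * t) := by
    intro t ht
    obtain ⟨h1, h2⟩ := hb ht
    rw [neg_lt, lt_div_iff₀ hmpos] at h1
    have h3 : m * t < 0 := mul_neg_of_pos_of_neg hmpos h2
    have h4 : m * t ∈ Set.Ioo (-r) r := ⟨by linarith, by linarith [hg.pos]⟩
    exact ⟨h2, h4, hg.map_zero ▸ hg.strictAntiOn h4 h0r h3⟩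
  -- An `m`-th root, so that `m` equal factors yield a coefficient which `Φ(D)^N` turns into exactly
  -- `b t`.
  have hroot : ∀ (t : ℝ) (N : ℕ), ∃ β : ℂ, β ^ m = b t / Φ ((m * t : ℝ) * u) ^ N := fun t N =>
    IsAlgClosed.exists_pow_nat_eq _ (Nat.pos_of_ne_zero hm0)
  choose β hβ using hroot
  have hβn : ∀ t ∈ b.support, ∀ N : ℕ,
      ‖β t N‖ ≤ (1 + ‖b t‖) * Real.exp (-(N * (g (m * t) / m))) := by
    intro t ht N
    refine le_of_pow_le_pow_left₀ hm0 (by positivity) ?_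
    rw [← norm_pow, hβ, norm_div, norm_pow, hg.norm_eq _ (hbt t ht).2.1, mul_pow,
      ← Real.exp_nat_mul, ← Real.exp_nat_mul, div_eq_mul_inv, ← Real.exp_neg]
    have e : (m : ℝ) * -(N * (g (m * t) / m)) = -(N * g (m * t)) := by field_simp
    rw [e]
    gcongr
    calc ‖b t‖ ≤ 1 + ‖b t‖ := by linarith
      _ ≤ (1 + ‖b t‖) ^ m := le_self_pow₀ (by linarith [norm_nonneg (b t)]) hm0
  -- Over the `m` factors of a monomial `ν` of degree `m` these exponents add up to `m (weight μ -
  -- weight ν)`: zero for `μ`, negative for its competitors.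
  set σ : ℕ → ℤ := fun i => Finsupp.weight w μ - m * w i with hσ
  set c : ℕ → ℝ → ℕ → ℂ := fun i t N =>
    if 0 < t then a i t else ((N : ℂ) + 1) ^ σ i * β t N with hc
  set C : ℕ → ℝ → ℝ := fun i t => if 0 < t then ‖a i t‖ else 1 + ‖b t‖ with hC
  set p : ℕ → ℝ → ℕ := fun i t => if 0 < t then 0 else (σ i).natAbs with hp
  have hcb : ∀ i, ∀ t ∈ (a i).support ∪ b.support, ∀ N, ‖c i t N‖ ≤
      C i t * (N + 1 : ℝ) ^ p i t * Real.exp (-(N * (max (g (m * t)) 0 / m))) := by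
    intro i t ht N
    rcases Finset.mem_union.1 ht with ht | ht
    · simp [hc, hC, hp, (hat i t ht).1, max_eq_right (hat i t ht).2.2.le]
    · simp only [hc, hC, hp, if_neg (hbt t ht).1.not_gt, max_eq_left (hbt t ht).2.2.le, norm_mul]
      have h1 := norm_natCast_add_one_zpow_le N (σ i)
      have h2 := hβn t ht N
      calc _ ≤ (N + 1 : ℝ) ^ (σ i).natAbs *
            ((1 + ‖b t‖) * Real.exp (-(N * (g (m * t) / m)))) := by gcongr
        _ = _ := by ring
  refine ⟨fun N i => ∑ t ∈ (a i).support ∪ b.support, c i t N • entireExp (t * u), ?_, ?_⟩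
  · rw [tendsto_pi_nhds]
    intro i
    have hdisj : Disjoint (a i).support b.support := by
      rw [Finset.disjoint_left]
      intro t h1 h2
      exact lt_asymm (hat i t h1).1 (hbt t h2).1
    simp only [Finset.sum_union hdisj]
    have h1 : ∀ N, ∑ t ∈ (a i).support, c i t N • entireExp (t * u) = A i := fun N => by
      rw [← haA i, Finsupp.linearCombination_apply, Finsupp.sum]
      refine Finset.sum_congr rfl fun t ht => ?_
      simp only [hc, if_pos (hat i t ht).1]
    have h2 : Tendsto (fun N => ∑ t ∈ b.support, c i t N • entireExp (t * u)) atTop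
        (𝓝 (∑ t ∈ b.support, (0 : ℂ) • entireExp (t * u))) := by
      refine tendsto_finsetSum _ fun t ht => Tendsto.smul_const ?_ _
      have h3 := (tendsto_add_one_pow_mul_exp_neg (p i t)
        (div_pos (hbt t ht).2.2 hmpos)).const_mul (C i t)
      rw [mul_zero] at h3
      refine squeeze_zero_norm (fun N => ?_) h3
      have := hcb i t (Finset.mem_union_right _ ht) N
      rwa [max_eq_left (hbt t ht).2.2.le, mul_assoc] at this
    simp only [h1]
    simpa using h2.const_add (A i)
  · intro ν hν
    obtain ⟨ι, hprod, hweight⟩ := Finsupp.exists_list (M := EntireFunctions) ν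
    simp only [hprod]
    have hn : 0 < ν.degree := by
      rw [Nat.pos_iff_ne_zero, Ne, Finsupp.degree_eq_zero_iff]
      exact hS ν hν
    set d : ℝ → ℂ := fun t => if ν = μ then b t else 0 with hd
    have key := hg.tendsto_iterate_prod hΦ hn (hlead ν hν).1 (fun k => (a (ι k)).support)
      b.support (fun k t ht => (hat _ t ht).1) (fun t ht => (hbt t ht).1)
      (fun k t ht => (Finset.mem_union.1 ht).elim (fun h => (hat _ t h).2.1)
        fun h => (hbt t h).2.1)
      (fun k => c (ι k)) (fun k => C (ι k)) (fun k => p (ι k)) (fun k => hcb (ι k)) d ?_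
    · convert! key using 2
      by_cases h : ν = μ
      · rw [if_pos h, if_pos (by rw [h]), Finsupp.linearCombination_apply, Finsupp.sum]
        refine Finset.sum_congr rfl fun t _ => ?_
        simp only [hd, if_pos h]
        congr 2
        push_cast
        ring
      · simp [h, hd]
    · intro hdeg t ht
      have hΦ0 : Φ ((m * t : ℝ) * u) ≠ 0 := by
        rw [← norm_pos_iff, hg.norm_eq _ (hbt t ht).2.1]
        exact Real.exp_pos _
      have e : ∀ N : ℕ, (∏ k, c (ι k) t N) * Φ ((m * t : ℝ) * u) ^ N =
          ((N : ℂ) + 1) ^ ((m : ℤ) * (Finsupp.weight w μ - Finsupp.weight w ν)) * b t := by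
        intro N
        have hN : (N : ℂ) + 1 ≠ 0 := by exact_mod_cast N.succ_ne_zero
        have hsum : ∑ k, σ (ι k) = (m : ℤ) * (Finsupp.weight w μ - Finsupp.weight w ν) := by
          simp only [hσ, Finset.sum_sub_distrib, ← Finset.mul_sum, hweight w]
          simp only [Finset.sum_const, Finset.card_univ, Fintype.card_fin, hdeg, nsmul_eq_mul]
          push_cast
          ring
        simp only [hc, if_neg (hbt t ht).1.not_gt, Finset.prod_mul_distrib, Finset.prod_const,
          Finset.card_univ, Fintype.card_fin]
        have hpow : β t N ^ ν.degree = b t / Φ ((m * t : ℝ) * u) ^ N := hdeg ▸ hβ t N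
        rw [hpow, ← hsum, mul_assoc, div_mul_cancel₀ _ (pow_ne_zero _ hΦ0),
          prod_zpow_eq_zpow_sum₀ hN]
      simp only [e]
      by_cases h : ν = μ
      · simp [h, hd]
      · have hlt := (hlead ν hν).2 h hdeg
        have := (tendsto_natCast_add_one_zpow_zero (z := (m : ℤ) * (Finsupp.weight w μ -
          Finsupp.weight w ν)) (mul_neg_of_pos_of_neg (by positivity) (by
            rw [sub_neg]; exact_mod_cast hlt))).mul_const (b t)
        simpa [hd, h] using this

/-! ### The Baire category argument. -/

theorem HasConvexDirection.dense_setOf_exists_iterate (hg : HasConvexDirection Φ u r g)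
    (hΦ : IsEntireOfExponentialType Φ) {S : Finset (ℕ →₀ ℕ)} (hS : ∀ ν ∈ S, ν ≠ 0)
    {μ : ℕ →₀ ℕ} (hμ : μ ∈ S) {w : ℕ → ℕ}
    (hlead : ∀ ν ∈ S, ν.degree ≤ μ.degree ∧
      (ν ≠ μ → ν.degree = μ.degree → Finsupp.weight w μ < Finsupp.weight w ν))
    {V W : Set EntireFunctions} (hV : IsOpen V) (hVne : V.Nonempty) (hW : IsOpen W)
    (h0W : 0 ∈ W) :
    Dense {f : ℕ → EntireFunctions | ∃ N, ∀ ν ∈ S,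
      (convolutionOperator Φ)^[N] (ν.prod fun i k => f i ^ k) ∈ if ν = μ then V else W} := by
  have hm0 : μ.degree ≠ 0 := by
    rw [Ne, Finsupp.degree_eq_zero_iff]
    exact hS μ hμ
  have hε : 0 < r / μ.degree := by have := hg.pos; positivity
  have hdense := dense_pi (Set.univ : Set ℕ) (fun _ _ => dense_span_entireExp_pos hg.ne_zero hε)
  -- The target is approximated along the direction `μ.degree * u`, since the surviving products
  -- have exponents `μ.degree * t * u`.
  have hmu : (μ.degree : ℂ) * u ≠ 0 := mul_ne_zero (by exact_mod_cast hm0) hg.ne_zero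
  obtain ⟨v, hvV, hv⟩ := (dense_span_entireExp_neg hmu hε).inter_open_nonempty V hV hVne
  refine dense_closure.1 (hdense.mono fun A hA => ?_)
  obtain ⟨f, hf, hlim⟩ := hg.exists_perturbation hΦ hS hμ hlead (fun i => hA i trivial) hv
  refine mem_closure_of_tendsto hf ?_
  have : ∀ᶠ N in atTop, ∀ ν ∈ S, (convolutionOperator Φ)^[N] (ν.prod fun i k => f N i ^ k) ∈
      if ν = μ then V else W := by
    rw [Filter.eventually_all_finset]
    intro ν hν
    refine (hlim ν hν).eventually_mem ?_
    split_ifs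
    · exact hV.mem_nhds hvV
    · exact hW.mem_nhds h0W
  exact this.mono fun N hN => ⟨N, hN⟩

theorem isOpen_setOf_exists_iterate (hΦ : IsEntireOfExponentialType Φ) (S : Finset (ℕ →₀ ℕ))
    (μ : ℕ →₀ ℕ) {V W : Set EntireFunctions} (hV : IsOpen V) (hW : IsOpen W) :
    IsOpen {f : ℕ → EntireFunctions | ∃ N, ∀ ν ∈ S,
      (convolutionOperator Φ)^[N] (ν.prod fun i k => f i ^ k) ∈ if ν = μ then V else W} := by
  simp only [Set.ofPred_exists, Set.ofPred_forall]
  refine isOpen_iUnion fun N => isOpen_biInter_finset fun ν _ => ?_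
  have hc : Continuous fun f : ℕ → EntireFunctions =>
      (convolutionOperator Φ)^[N] (ν.prod fun i k => f i ^ k) := by
    refine (hΦ.continuous_convolutionOperator.iterate N).comp ?_
    exact continuous_finsetProd _ fun i _ => (continuous_apply i).pow _
  refine IsOpen.preimage hc ?_
  split_ifs
  · exact hV
  · exact hW

/-- Changing one coordinate of ever larger index does not affect the limit in the product topology.
-/
theorem dense_setOf_exists_apply_mem {X : Type*} [TopologicalSpace X] {V : Set X}
    (hV : V.Nonempty) : Dense {f : ℕ → X | ∃ i, f i ∈ V} := by
  classical
  obtain ⟨v, hv⟩ := hV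
  intro f
  have h : Tendsto (fun n => Function.update f n v) atTop (𝓝 f) := by
    rw [tendsto_pi_nhds]
    intro i
    refine tendsto_const_nhds.congr' ?_
    filter_upwards [eventually_gt_atTop i] with n hn
    rw [Function.update_of_ne hn.ne]
  exact mem_closure_of_tendsto h (Eventually.of_forall fun n => ⟨n, by simpa using hv⟩)

open TopologicalSpace in
/-- A sequence of entire functions, generic in the sense of Baire category. -/
theorem HasConvexDirection.exists_generic (hg : HasConvexDirection Φ u r g)
    (hΦ : IsEntireOfExponentialType Φ) :
    ∃ f : ℕ → EntireFunctions, Dense (Set.range f) ∧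
      ∀ S : Finset (ℕ →₀ ℕ), S.Nonempty → (∀ ν ∈ S, ν ≠ 0) → ∃ μ ∈ S,
        ∀ V ∈ countableBasis EntireFunctions, ∀ W ∈ countableBasis EntireFunctions, 0 ∈ W →
          ∃ N, ∀ ν ∈ S, (convolutionOperator Φ)^[N] (ν.prod fun i k => f i ^ k) ∈
            if ν = μ then V else W := by
  have := baireSpace_entireFunctions_seq
  set B := countableBasis EntireFunctions with hB
  have hBc : B.Countable := countable_countableBasis _
  have hBo : ∀ V ∈ B, IsOpen V := fun V hV => isOpen_of_mem_countableBasis hV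
  have hBn : ∀ V ∈ B, V.Nonempty := fun V hV => nonempty_of_mem_countableBasis hV
  have h1 : ∀ᶠ f in residual (ℕ → EntireFunctions), ∀ V ∈ B, ∃ i, f i ∈ V := by
    rw [eventually_countable_ball hBc]
    intro V hV
    refine residual_of_dense_open ?_ (dense_setOf_exists_apply_mem (hBn V hV))
    simp only [Set.ofPred_exists]
    exact isOpen_iUnion fun i => (hBo V hV).preimage (continuous_apply i)
  have h2 : ∀ᶠ f in residual (ℕ → EntireFunctions), ∀ S : Finset (ℕ →₀ ℕ), S.Nonempty →
      (∀ ν ∈ S, ν ≠ 0) → ∃ μ ∈ S, ∀ V ∈ B, ∀ W ∈ B, 0 ∈ W →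
        ∃ N, ∀ ν ∈ S, (convolutionOperator Φ)^[N] (ν.prod fun i k => f i ^ k) ∈
          if ν = μ then V else W := by
    rw [eventually_countable_forall]
    intro S
    by_cases hS : S.Nonempty ∧ ∀ ν ∈ S, ν ≠ 0
    · obtain ⟨μ, hμ, w, hlead⟩ := Finsupp.exists_leading hS.1
      have : ∀ᶠ f in residual (ℕ → EntireFunctions), ∀ V ∈ B, ∀ W ∈ B, 0 ∈ W →
          ∃ N, ∀ ν ∈ S, (convolutionOperator Φ)^[N] (ν.prod fun i k => f i ^ k) ∈
            if ν = μ then V else W := by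
        rw [eventually_countable_ball hBc]
        intro V hV
        rw [eventually_countable_ball hBc]
        intro W hW
        rw [eventually_imp_distrib_left]
        intro h0
        exact residual_of_dense_open (isOpen_setOf_exists_iterate hΦ S μ (hBo V hV) (hBo W hW))
          (hg.dense_setOf_exists_iterate hΦ hS.2 hμ hlead (hBo V hV) (hBn V hV) (hBo W hW) h0)
      filter_upwards [this] with f hf _ _
      exact ⟨μ, hμ, hf⟩
    · exact Eventually.of_forall fun f h h' => absurd ⟨h, h'⟩ hS
  obtain ⟨f, hf1, hf2⟩ := (dense_of_mem_residual (h1.and h2)).nonempty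
  refine ⟨f, (isBasis_countableBasis _).dense_iff.2 fun V hV _ => ?_, hf2⟩
  obtain ⟨i, hi⟩ := hf1 V hV
  exact ⟨f i, hi, i, rfl⟩

/-! ### From a generic sequence to a free dense algebra. -/

open TopologicalSpace in
theorem IsEntireOfExponentialType.aeval_mem_hypercyclicVectors (hΦ : IsEntireOfExponentialType Φ)
    {f : ℕ → EntireFunctions} {P : MvPolynomial ℕ ℂ} {μ : ℕ →₀ ℕ} (hμ : μ ∈ P.support)
    (h : ∀ V ∈ countableBasis EntireFunctions, ∀ W ∈ countableBasis EntireFunctions, 0 ∈ W →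
      ∃ N, ∀ ν ∈ P.support, (convolutionOperator Φ)^[N] (ν.prod fun i k => f i ^ k) ∈
        if ν = μ then V else W) :
    MvPolynomial.aeval f P ∈ hypercyclicVectors (convolutionOperator Φ) := by
  classical
  have hbasis := isBasis_countableBasis EntireFunctions
  have hcμ : P.coeff μ ≠ 0 := MvPolynomial.mem_support_iff.1 hμ
  have hexp : ∀ N, (convolutionOperator Φ)^[N] (MvPolynomial.aeval f P) =
      ∑ ν ∈ P.support, P.coeff ν • (convolutionOperator Φ)^[N] (ν.prod fun i k => f i ^ k) := by
    intro N
    have hpow : ∀ x, (convolutionOperator Φ)^[N] x = (hΦ.convolutionLinearMap ^ N) x := fun x => by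
      rw [Module.End.pow_apply]
      rfl
    simp only [hpow, MvPolynomial.aeval_def, MvPolynomial.eval₂_eq, map_sum, ← map_smul]
    refine Finset.sum_congr rfl fun ν _ => ?_
    rw [Algebra.smul_def]
    rfl
  refine dense_iff_inter_open.2 fun U hU ⟨x, hx⟩ => ?_
  -- Ideal values of the iterated monomials: the leading one alone produces the target `x`, so
  -- nearby values land in `U`.
  set q₀ : (ℕ →₀ ℕ) → EntireFunctions := fun ν => if ν = μ then (P.coeff μ)⁻¹ • x else 0 with hq₀
  have hcont : Continuous fun q : (ℕ →₀ ℕ) → EntireFunctions =>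
      ∑ ν ∈ P.support, P.coeff ν • q ν :=
    continuous_finsetSum _ fun ν _ =>
      (continuous_const_smul (P.coeff ν)).comp (continuous_apply (A := fun _ => EntireFunctions) ν)
  have hval : ∑ ν ∈ P.support, P.coeff ν • q₀ ν = x := by
    rw [Finset.sum_eq_single μ]
    · simp [hq₀, smul_smul, hcμ]
    · intro ν _ hne
      simp [hq₀, hne]
    · exact fun h => absurd hμ h
  have hU' : (fun q : (ℕ →₀ ℕ) → EntireFunctions => ∑ ν ∈ P.support, P.coeff ν • q ν) ⁻¹' U ∈
      𝓝 q₀ := hcont.continuousAt.preimage_mem_nhds (hU.mem_nhds (by rwa [hval]))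
  rw [nhds_pi, Filter.mem_pi'] at hU'
  obtain ⟨I, t, ht, hsub⟩ := hU'
  obtain ⟨V, hV, hyV, hVt⟩ := hbasis.mem_nhds_iff.1 (ht μ)
  have hW : ⋂ ν ∈ I.erase μ, t ν ∈ 𝓝 (0 : EntireFunctions) := by
    rw [Filter.biInter_finset_mem]
    intro ν hν
    have := ht ν
    simpa only [hq₀, if_neg (Finset.ne_of_mem_erase hν)] using this
  obtain ⟨W, hW, h0W, hWt⟩ := hbasis.mem_nhds_iff.1 hW
  obtain ⟨N, hN⟩ := h V hV W hW h0W
  refine ⟨_, ?_, N, rfl⟩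
  simp only [hexp]
  -- The finite set `I` of constrained indices may leave the support; the default `0` agrees with
  -- `q₀` there.
  set q : (ℕ →₀ ℕ) → EntireFunctions := fun ν =>
    if ν ∈ P.support then (convolutionOperator Φ)^[N] (ν.prod fun i k => f i ^ k) else 0 with hq
  have hqU : q ∈ (I : Set (ℕ →₀ ℕ)).pi t := by
    intro ν hν
    by_cases hνμ : ν = μ
    · subst hνμ
      have := hN ν hμ
      rw [if_pos rfl] at this
      simpa only [hq, if_pos hμ] using hVt this
    · have hmem : ∀ z ∈ W, z ∈ t ν := fun z hz =>
        Set.mem_iInter₂.1 (hWt hz) ν (Finset.mem_erase.2 ⟨hνμ, hν⟩)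
      by_cases hνS : ν ∈ P.support
      · have := hN ν hνS
        rw [if_neg hνμ] at this
        simpa only [hq, if_pos hνS] using hmem _ this
      · simpa only [hq, if_neg hνS] using hmem _ h0W
  have := hsub hqU
  rw [Set.mem_preimage] at this
  convert! this using 1
  refine Finset.sum_congr rfl fun ν hν => ?_
  rw [hq]
  simp only [if_pos hν]

theorem IsEntireOfExponentialType.zero_notMem_hypercyclicVectors
    (hΦ : IsEntireOfExponentialType Φ) : 0 ∉ hypercyclicVectors (convolutionOperator Φ) := by
  intro h
  have h0 : ∀ n, (convolutionOperator Φ)^[n] 0 = 0 := fun n =>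
    Function.iterate_fixed hΦ.convolutionLinearMap.map_zero n
  simp only [hypercyclicVectors, Set.mem_ofPred_eq, h0, Set.range_const] at h
  have h1 : (1 : EntireFunctions) ∈ closure {0} := h 1
  rw [closure_singleton, Set.mem_singleton_iff] at h1
  have := congrArg (EntireFunctions.evalAt 0) h1
  simp at this

theorem exists_aeval_of_mem_adjoin_range {R A σ : Type*} [CommRing R] [CommRing A] [Algebra R A]
    {f : σ → A} {x : A} (hx : x ∈ NonUnitalAlgebra.adjoin R (Set.range f)) :
    ∃ P : MvPolynomial σ R, MvPolynomial.constantCoeff P = 0 ∧ MvPolynomial.aeval f P = x := by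
  induction hx using NonUnitalAlgebra.adjoin_induction with
  | mem x hx =>
    obtain ⟨i, rfl⟩ := hx
    exact ⟨MvPolynomial.X i, by simp, by simp⟩
  | add x y _ _ hx hy =>
    obtain ⟨P, hP, rfl⟩ := hx
    obtain ⟨Q, hQ, rfl⟩ := hy
    exact ⟨P + Q, by simp [hP, hQ], by simp⟩
  | zero => exact ⟨0, by simp, by simp⟩
  | mul x y _ _ hx hy =>
    obtain ⟨P, hP, rfl⟩ := hx
    obtain ⟨Q, hQ, rfl⟩ := hy
    exact ⟨P * Q, by simp [hP], by simp⟩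
  | smul c x _ hx =>
    obtain ⟨P, hP, rfl⟩ := hx
    exact ⟨c • P, by simp [hP, MvPolynomial.smul_eq_C_mul], by simp⟩

theorem corollary4p3 (Φ : ℂ → ℂ) (hΦ : IsEntireOfExponentialType Φ) (h0 : ‖Φ 0‖ = 1)
    (h2 : iteratedDeriv 2 Φ 0 * Φ 0 ≠ (deriv Φ 0) ^ 2) (h1 : deriv Φ 0 ≠ 0) :
    DenselyStronglyAlgebrable (hypercyclicVectors (convolutionOperator Φ)) := by
  obtain ⟨u, r, g, hg⟩ := exists_hasConvexDirection hΦ.1 h0 h2 h1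
  obtain ⟨f, hdense, hf⟩ := hg.exists_generic hΦ
  have hyper : ∀ P : MvPolynomial ℕ ℂ, P ≠ 0 → MvPolynomial.constantCoeff P = 0 →
      MvPolynomial.aeval f P ∈ hypercyclicVectors (convolutionOperator Φ) := by
    intro P hP hP0
    obtain ⟨μ, hμ, h⟩ := hf P.support (MvPolynomial.support_nonempty.2 hP) (by
      rintro ν hν rfl
      exact MvPolynomial.mem_support_iff.1 hν hP0)
    exact hΦ.aeval_mem_hypercyclicVectors hμ h
  have hind : AlgebraicIndependent ℂ f := by
    rw [algebraicIndependent_iff]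
    intro P hP
    by_contra hne
    -- A relation `P` may have a constant term; multiplying by a variable removes it and keeps the
    -- polynomial nonzero.
    have := hyper (MvPolynomial.X 0 * P) (mul_ne_zero (MvPolynomial.X_ne_zero 0) hne) (by simp)
    rw [map_mul, hP, mul_zero] at this
    exact hΦ.zero_notMem_hypercyclicVectors this
  refine ⟨Set.range f, Set.infinite_range_of_injective hind.injective, hind.coe_range,
    hdense.mono (NonUnitalAlgebra.subset_adjoin ℂ), fun x hx => ?_⟩
  obtain ⟨P, hP, rfl⟩ := exists_aeval_of_mem_adjoin_range hx
  by_cases hne : P = 0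
  · right
    simp [hne]
  · exact Or.inl (hyper P hne hP)
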